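/- Let $X$ be a complex Banach space and $L(X)$ the algebra of bounded linear operators on $X$. For $S\in L(X)$ write $\mathcal N(S)$ and $\mathcal R(S)$ for its kernel and range, $\alpha(S)=\dim\mathcal N(S)$ and $\beta(S)=\operatorname{codim}\mathcal R(S)$, where dimensions and codimensions take values in $\mathbb N\cup\{\infty\}$, and $$\mathcal K(S)=\{x\in X:\ \exists\,\varepsilon>0,\ \exists\,(u_n)_{n\ge0}\subset X,\ u_0=x,\ Su_{n+1}=u_n,\ \|u_n\|\le\varepsilon^n\|x\|\ \ \forall n\ge 0\},$$ $$\mathcal H_0(S)=\{x\in X:\ \lim_{n\to\infty}\|S^nx\|^{1/n}=0\}.$$ A bounded operator $S$ on a Banach space is called semi-regular if $\mathcal R(S)$ is closed and $\mathcal N(S)\subset\mathcal R(S^n)$ for every $n\in\mathbb N$; quasi-nilpotent if $S-\mu I$ is invertible for every complex $\mu\ne0$; and zeroloid if every accumulation point of its spectrum $\sigma(S)$ is equal to $0$. For $T\in L(X)$ write $(M,N)\in\mathrm{Red}(T)$ if $M,N$ are closed $T$-invariant subspaces of $X$ with $X=M\oplus N$, and let $T_M\in L(M)$, $T_N\in L(N)$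 be the restrictions of $T$. The operator $T$ is pseudo-Fredholm if there is $(M,N)\in\mathrm{Red}(T)$ such that $T_M$ is semi-regular and $T_N$ is quasi-nilpotent. Write $(M,N)\in g_zKD(T)$ if $(M,N)\in\mathrm{Red}(T)$, $T_M$ is semi-regular and $T_N$ is zeroloid; $T$ is $g_z$-Kato if such a pair exists. Theorem. Let $T\in L(X)$ be a $g_z$-Kato operator. For every $(M,N)\in g_zKD(T)$ there exists $\epsilon>0$ such that for all $\lambda\in\mathbb C$ with $0<|\lambda|<\epsilon$: (i) $T-\lambda I$ is pseudo-Fredholm; (ii) $\alpha(T_M)=\dim\big(\mathcal N(T-\lambda I)\cap\mathcal K(T-\lambda I)\big)\le\alpha(T-\lambda I)$; (iii) $\beta(T_M)=\operatorname{codim}\big(\mathcal R(T-\lambda I)+\mathcal H_0(T-\lambda I)\big)\le\beta(T-\lambda I)$. -/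

import Mathlib

open Filter Topology

namespace GzKato

section

variable {X : Type*} [NormedAddCommGroup X] [NormedSpace ℂ X]

/-- The dimension of a complex vector space, as an element of `ℕ ∪ {∞}`. -/
noncomputable def dim (V : Type*) [AddCommGroup V] [Module ℂ V] : ℕ∞ :=
  Cardinal.toENat (Module.rank ℂ V)

/-- The codimension of a subspace, as an element of `ℕ ∪ {∞}`. -/
noncomputable def codim (W : Submodule ℂ X) : ℕ∞ :=
  dim (X ⧸ W)

/-- The kernel `N(T)`. -/
def nullSpace (T : X →L[ℂ] X) : Submodule ℂ X :=
  LinearMap.ker (T : X →ₗ[ℂ] X)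

/-- The range `R(T)`. -/
def rangeSpace (T : X →L[ℂ] X) : Submodule ℂ X :=
  LinearMap.range (T : X →ₗ[ℂ] X)

/-- The nullity `α(T) = dim N(T)`. -/
noncomputable def nullity (T : X →L[ℂ] X) : ℕ∞ :=
  dim (nullSpace T)

/-- The deficiency `β(T) = codim R(T)`. -/
noncomputable def deficiency (T : X →L[ℂ] X) : ℕ∞ :=
  codim (rangeSpace T)

/-- The restriction `T_M : M → M` of `T` to a `T`-invariant subspace `M`. -/
def restr (T : X →L[ℂ] X) (M : Submodule ℂ X) (hM : ∀ x ∈ M, T x ∈ M) : M →L[ℂ] M :=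
  T.restrict hM

/-- `T` is semi-regular: its range is closed and `N(T) ⊆ R(Tⁿ)` for every `n`. -/
def IsSemiRegular (T : X →L[ℂ] X) : Prop :=
  IsClosed (rangeSpace T : Set X) ∧ ∀ n : ℕ, nullSpace T ≤ rangeSpace (T ^ n)

/-- `T` is quasi-nilpotent: `T - μI` is invertible in `L(X)` for every `μ ≠ 0`. -/
def IsQuasiNilpotent (T : X →L[ℂ] X) : Prop :=
  ∀ μ : ℂ, μ ≠ 0 → IsUnit (T - μ • (1 : X →L[ℂ] X))

/-- `T` is zeroloid: the spectrum of `T` has no accumulation point other than `0`. -/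
def IsZeroloid (T : X →L[ℂ] X) : Prop :=
  {μ : ℂ | AccPt μ (𝓟 (spectrum ℂ T))} ⊆ {0}

/-- `(M, N) ∈ Red(T)`: `M` and `N` are closed `T`-invariant subspaces with `X = M ⊕ N`. -/
structure IsRed (T : X →L[ℂ] X) (M N : Submodule ℂ X) : Prop where
  isClosed_left : IsClosed (M : Set X)
  isClosed_right : IsClosed (N : Set X)
  invariant_left : ∀ x ∈ M, T x ∈ M
  invariant_right : ∀ x ∈ N, T x ∈ N
  isCompl : IsCompl M N

/-- `(M, N)` is a generalized Kato zeroloid decomposition of `T`: it reduces `T`,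
`T_M` is semi-regular and `T_N` is zeroloid. -/
structure IsGzKD (T : X →L[ℂ] X) (M N : Submodule ℂ X) : Prop extends IsRed T M N where
  semiRegular : IsSemiRegular (restr T M invariant_left)
  zeroloid : IsZeroloid (restr T N invariant_right)

/-- `(M, N)` is a pseudo-Fredholm decomposition of `T`: it reduces `T`,
`T_M` is semi-regular and `T_N` is quasi-nilpotent. -/
structure IsGKD (T : X →L[ℂ] X) (M N : Submodule ℂ X) : Prop extends IsRed T M N where
  semiRegular : IsSemiRegular (restr T M invariant_left)
  quasiNilpotent : IsQuasiNilpotent (restr T N invariant_right)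

/-- `T` is pseudo-Fredholm: it has a pseudo-Fredholm decomposition. -/
def IsPseudoFredholm (T : X →L[ℂ] X) : Prop :=
  ∃ M N : Submodule ℂ X, IsGKD T M N

/-- The analytic core `K(T)`. -/
def analyticCore (T : X →L[ℂ] X) : Submodule ℂ X where
  carrier := {x | ∃ ε : ℝ, 0 < ε ∧ ∃ u : ℕ → X,
    x = u 0 ∧ (∀ n, T (u (n + 1)) = u n) ∧ ∀ n, ‖u n‖ ≤ ε ^ n * ‖x‖}
  zero_mem' := ⟨1, one_pos, fun _ => 0, by simp⟩
  add_mem' := by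
    rintro x y ⟨a, ha, u, hxu, hu, hua⟩ ⟨b, hb, v, hyv, hv, hvb⟩
    rcases eq_or_ne (x + y) 0 with h0 | h0
    · exact ⟨1, one_pos, fun _ => 0, by simp [h0]⟩
    have hpos : 0 < ‖x + y‖ := norm_pos_iff.mpr h0
    set C : ℝ := max 1 ((‖x‖ + ‖y‖) / ‖x + y‖) with hC
    have hC1 : 1 ≤ C := le_max_left _ _
    have hC2 : ‖x‖ + ‖y‖ ≤ C * ‖x + y‖ := by
      rw [← div_le_iff₀ hpos]
      exact le_max_right _ _
    have hm : 0 < max a b := lt_max_of_lt_left ha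
    refine ⟨max a b * C, by positivity, fun n => u n + v n, by rw [hxu, hyv],
      fun n => by rw [map_add, hu, hv], fun n => ?_⟩
    rcases Nat.eq_zero_or_pos n with rfl | hn
    · simp [← hxu, ← hyv]
    calc ‖u n + v n‖ ≤ ‖u n‖ + ‖v n‖ := norm_add_le _ _
      _ ≤ a ^ n * ‖x‖ + b ^ n * ‖y‖ := add_le_add (hua n) (hvb n)
      _ ≤ max a b ^ n * ‖x‖ + max a b ^ n * ‖y‖ := by
        gcongr
        · exact le_max_left _ _
        · exact le_max_right _ _
      _ = max a b ^ n * (‖x‖ + ‖y‖) := by ring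
      _ ≤ max a b ^ n * (C ^ n * ‖x + y‖) := by
        gcongr
        exact hC2.trans (by gcongr; exact le_self_pow₀ hC1 hn.ne')
      _ = (max a b * C) ^ n * ‖x + y‖ := by ring
  smul_mem' := by
    rintro c x ⟨a, ha, u, hxu, hu, hua⟩
    refine ⟨a, ha, fun n => c • u n, by rw [hxu], fun n => by rw [map_smul, hu], fun n => ?_⟩
    rw [norm_smul, norm_smul, mul_left_comm]
    exact mul_le_mul_of_nonneg_left (hua n) (norm_nonneg c)

/-- The quasi-nilpotent part `H₀(T)`. -/
def quasiNilpotentPart (T : X →L[ℂ] X) : Submodule ℂ X where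
  carrier := {x | Tendsto (fun n : ℕ => ‖(T ^ n) x‖ ^ (1 / (n : ℝ))) atTop (𝓝 0)}
  zero_mem' := by
    refine Tendsto.congr' (f₁ := fun _ => (0 : ℝ)) ?_ tendsto_const_nhds
    filter_upwards [eventually_ne_atTop 0] with n hn
    rw [map_zero, norm_zero, Real.zero_rpow]
    positivity
  add_mem' := by
    intro x y hx hy
    have hxy := Tendsto.add hx hy
    rw [add_zero] at hxy
    refine squeeze_zero' (Eventually.of_forall fun n => by positivity) ?_ hxy
    filter_upwards [eventually_ge_atTop 1] with n hn
    have h1 : (1 : ℝ) ≤ n := by exact_mod_cast hn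
    have hp0 : (0 : ℝ) ≤ 1 / (n : ℝ) := by positivity
    have hp1 : 1 / (n : ℝ) ≤ 1 := by
      rw [div_le_one (by linarith)]
      exact h1
    calc ‖(T ^ n) (x + y)‖ ^ (1 / (n : ℝ))
        ≤ (‖(T ^ n) x‖ + ‖(T ^ n) y‖) ^ (1 / (n : ℝ)) := by
          rw [map_add]
          exact Real.rpow_le_rpow (norm_nonneg _) (norm_add_le _ _) hp0
      _ ≤ _ := Real.rpow_add_le_add_rpow (norm_nonneg _) (norm_nonneg _) hp0 hp1
  smul_mem' := by
    intro c x hx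
    have hcx := Tendsto.const_mul (max 1 ‖c‖) hx
    rw [mul_zero] at hcx
    refine squeeze_zero' (Eventually.of_forall fun n => by positivity) ?_ hcx
    filter_upwards [eventually_ge_atTop 1] with n hn
    have h1 : (1 : ℝ) ≤ n := by exact_mod_cast hn
    have hp0 : (0 : ℝ) ≤ 1 / (n : ℝ) := by positivity
    have hp1 : 1 / (n : ℝ) ≤ 1 := by
      rw [div_le_one (by linarith)]
      exact h1
    rw [map_smul, norm_smul, Real.mul_rpow (norm_nonneg _) (norm_nonneg _)]
    gcongr
    calc ‖c‖ ^ (1 / (n : ℝ)) ≤ max 1 ‖c‖ ^ (1 / (n : ℝ)) :=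
          Real.rpow_le_rpow (norm_nonneg _) (le_max_right _ _) hp0
      _ ≤ max 1 ‖c‖ ^ (1 : ℝ) := Real.rpow_le_rpow_of_exponent_le (le_max_left _ _) hp1
      _ = max 1 ‖c‖ := Real.rpow_one _

end

end GzKato

/-!
For `μ ≠ 0` near `0` the operator `T_M - μ` is semi-regular with the nullity and the deficiency of
`T_M`. As `μ` is not an accumulation point of the spectrum of `T_N`, the coefficient at `(z - μ)⁻¹`
of the Laurent expansion of the resolvent of `T_N` at `μ` splits `N` into a part on which `T - μ` is
invertible and a part on which it is quasi-nilpotent. Adding the invertible part to `M` gives a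
pseudo-Fredholm decomposition `(M', N')` of `T - μ`, with the nullity and the deficiency of
`(T - μ)_M'` unchanged. These are intrinsic: the kernel of a semi-regular operator lies in its
analytic core and its range contains its quasi-nilpotent part, while a quasi-nilpotent operator has
zero analytic core and full quasi-nilpotent part, so that `N(S) ∩ K(S)` is the kernel of `S_M'` and
`R(S) + H₀(S)` is `R(S_M') ⊕ N'` for `S = T - μ`.

Both the semi-regularity of `S - μ` and the two inclusions for a semi-regular `S` come from its
hyperrange `K = ⋂ₙ R(Sⁿ)`: it is closed, `S` maps it onto itself, and the operator induced on the
quotient by `K` is bounded below. Surjectivity and being bounded below are open conditions, under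
which the dimension of the kernel, respectively the codimension of the range, is locally constant.
-/

namespace GzKato

open Asymptotics Metric

section Decay

variable {E F : Type*} [NormedAddCommGroup E] [NormedAddCommGroup F] {u : ℕ → E} {v : ℕ → F}

/-- A sequence that tends to zero faster than every geometric sequence. -/
def DecaysSuperexponentially (u : ℕ → E) : Prop :=
  ∀ r : ℝ, 0 < r → u =O[atTop] fun n => r ^ n

theorem decaysSuperexponentially_iff_eventually_norm_le :
    DecaysSuperexponentially u ↔ ∀ r : ℝ, 0 < r → ∀ᶠ n in atTop, ‖u n‖ ≤ r ^ n := by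
  refine ⟨fun h r hr => ?_, fun h r hr => IsBigO.of_bound 1 ?_⟩
  · have hlt : (fun n => (r / 2) ^ n) =o[atTop] fun n : ℕ => r ^ n :=
      isLittleO_pow_pow_of_lt_left (half_pos hr).le (half_lt_self hr)
    filter_upwards [((h (r / 2) (half_pos hr)).trans_isLittleO hlt).bound one_pos] with n hn
    simpa [abs_of_pos hr] using hn
  · filter_upwards [h r hr] with n hn
    simpa [abs_of_pos hr] using hn

theorem decaysSuperexponentially_iff_tendsto_rpow :
    DecaysSuperexponentially u ↔ Tendsto (fun n : ℕ => ‖u n‖ ^ (1 / (n : ℝ))) atTop (𝓝 0) := by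
  have rpow_le_iff {n : ℕ} (hn : n ≠ 0) {r : ℝ} (hr : 0 < r) :
      ‖u n‖ ^ (1 / (n : ℝ)) ≤ r ↔ ‖u n‖ ≤ r ^ n := by
    rw [one_div, Real.rpow_inv_le_iff_of_pos (norm_nonneg _) hr.le (by positivity),
      Real.rpow_natCast]
  rw [decaysSuperexponentially_iff_eventually_norm_le,
    Metric.nhds_basis_closedBall.tendsto_right_iff]
  refine forall₂_congr fun r hr => eventually_congr ?_
  filter_upwards [eventually_ne_atTop 0] with n hn
  rw [mem_closedBall_zero_iff, Real.norm_of_nonneg (by positivity), rpow_le_iff hn hr]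

theorem DecaysSuperexponentially.of_norm_le (hu : DecaysSuperexponentially u) {K : ℝ}
    (h : ∀ n, ‖v n‖ ≤ K * ‖u n‖) : DecaysSuperexponentially v :=
  fun r hr => (IsBigO.of_bound K (Eventually.of_forall h)).trans (hu r hr)

theorem DecaysSuperexponentially.eq_zero_of_norm_le (hu : DecaysSuperexponentially u) {a : F}
    {C R : ℝ} (hR : 0 < R) (h : ∀ n, ‖a‖ ≤ C * R ^ n * ‖u n‖) : a = 0 := by
  have hsmall : (fun n => R ^ n * ‖u n‖) =O[atTop] fun n : ℕ => ((1 / 2 : ℝ)) ^ n := by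
    refine ((isBigO_refl (fun n : ℕ => R ^ n) atTop).mul
      (hu (1 / (2 * R)) (by positivity)).norm_left).congr_right fun n => ?_
    rw [← mul_pow]
    congr 1
    field_simp
  have hlim : Tendsto (fun n => C * (R ^ n * ‖u n‖)) atTop (𝓝 (C * 0)) :=
    (hsmall.trans_tendsto (tendsto_pow_atTop_nhds_zero_of_lt_one (by norm_num)
      (by norm_num))).const_mul C
  rw [mul_zero] at hlim
  refine norm_le_zero_iff.mp (ge_of_tendsto' hlim fun n => ?_)
  rw [← mul_assoc]
  exact h n

end Decay

section LaurentCoefficients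

variable {A : Type*} [NormedRing A] [NormedAlgebra ℂ A]

theorem circleIntegral_comp_comm {E F : Type*} [NormedAddCommGroup E] [NormedSpace ℂ E]
    [CompleteSpace E] [NormedAddCommGroup F] [NormedSpace ℂ F] [CompleteSpace F] (L : E →L[ℂ] F)
    {f : ℂ → E} {c : ℂ} {r : ℝ} (hf : CircleIntegrable f c r) :
    (∮ z in C(c, r), L (f z)) = L (∮ z in C(c, r), f z) := by
  simpa only [circleIntegral, map_smul] using L.intervalIntegral_comp_comm hf.out

theorem mul_resolvent {s : A} {z : ℂ} (hz : z ∈ resolventSet ℂ s) :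
    s * resolvent s z = z • resolvent s z - 1 := by
  have hinv : (algebraMap ℂ A z - s) * resolvent s z = 1 := Ring.mul_inverse_cancel _ hz
  rw [← hinv, sub_mul, ← Algebra.smul_def, sub_sub_cancel]

theorem resolvent_mul {s : A} {z : ℂ} (hz : z ∈ resolventSet ℂ s) :
    resolvent s z * s = z • resolvent s z - 1 := by
  have hinv : resolvent s z * (algebraMap ℂ A z - s) = 1 := Ring.inverse_mul_cancel _ hz
  rw [← hinv, mul_sub, ← Algebra.commutes, ← Algebra.smul_def, sub_sub_cancel]

/-- The coefficient of `z ^ (-k - 1)` in the Laurent expansion of the resolvent of `s` on an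
annulus around `0` that contains the circle of radius `r`. -/
noncomputable def laurentCoeff (s : A) (r : ℝ) (k : ℤ) : A :=
  (2 * Real.pi * Complex.I : ℂ)⁻¹ • ∮ z in C(0, r), z ^ k • resolvent s z

variable [CompleteSpace A] {s : A} {r : ℝ}

theorem differentiableOn_zpow_smul_resolvent (k : ℤ) :
    DifferentiableOn ℂ (fun z => z ^ k • resolvent s z) (resolventSet ℂ s \ {0}) := fun _ hz =>
  ((differentiableAt_zpow.mpr (Or.inl hz.2)).smul
    (spectrum.hasDerivAt_resolvent_const_left hz.1).differentiableAt).differentiableWithinAt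

theorem sphere_subset_closedBall_diff_singleton {ρ : ℝ} (hr : 0 < r) (hrρ : r ≤ ρ) :
    sphere (0 : ℂ) r ⊆ closedBall 0 ρ \ {0} := fun _ hz =>
  ⟨closedBall_subset_closedBall hrρ (sphere_subset_closedBall hz), ne_of_mem_sphere hz hr.ne'⟩

theorem circleIntegrable_zpow_smul_resolvent (hr : 0 < r) (hs : sphere 0 r ⊆ resolventSet ℂ s)
    (k : ℤ) : CircleIntegrable (fun z => z ^ k • resolvent s z) 0 r :=
  ((differentiableOn_zpow_smul_resolvent k).continuousOn.mono fun _ hz =>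
    ⟨hs hz, ne_of_mem_sphere hz hr.ne'⟩).circleIntegrable hr.le

theorem laurentCoeff_eq_of_le {r' : ℝ} (hr : 0 < r) (hrr' : r ≤ r')
    (hs : closedBall 0 r' \ ball 0 r ⊆ resolventSet ℂ s) (k : ℤ) :
    laurentCoeff s r' k = laurentCoeff s r k := by
  have hsub : closedBall 0 r' \ ball 0 r ⊆ resolventSet ℂ s \ {0} := fun z hz =>
    ⟨hs hz, fun h0 => hz.2 (h0 ▸ mem_ball_self hr)⟩
  have hopen : IsOpen (resolventSet ℂ s \ {0}) :=
    (spectrum.isOpen_resolventSet s).sdiff isClosed_singleton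
  have hd := differentiableOn_zpow_smul_resolvent (s := s) k
  rw [laurentCoeff, laurentCoeff]
  congr 1
  refine Complex.circleIntegral_eq_of_differentiable_on_annulus_off_countable hr hrr'
    Set.countable_empty (hd.continuousOn.mono hsub) fun z hz => ?_
  exact hd.differentiableAt (hopen.mem_nhds (hsub
    ⟨ball_subset_closedBall hz.1.1, fun h => hz.1.2 (ball_subset_closedBall h)⟩))

theorem circleIntegral_zpow_smul_smul_resolvent_sub_one (hr : 0 < r)
    (hs : sphere 0 r ⊆ resolventSet ℂ s) (k : ℤ) :
    (2 * Real.pi * Complex.I : ℂ)⁻¹ • (∮ z in C(0, r), z ^ k • (z • resolvent s z - 1)) =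
      laurentCoeff s r (k + 1) - if k = -1 then 1 else 0 := by
  have hsplit : Set.EqOn (fun z : ℂ => z ^ k • (z • resolvent s z - 1))
      (fun z => z ^ (k + 1) • resolvent s z - (z - 0) ^ k • (1 : A)) (sphere 0 r) :=
    fun z hz => by
      simp only [smul_sub, smul_smul, sub_zero, zpow_add_one₀ (ne_of_mem_sphere hz hr.ne')]
  have hone : CircleIntegrable (fun z : ℂ => (z - 0) ^ k • (1 : A)) 0 r :=
    (circleIntegrable_sub_zpow_iff.mpr <| Or.inr <| Or.inr fun h0 =>
      ne_of_mem_sphere h0 (abs_pos.mpr hr.ne').ne' rfl).smul_continuousOn continuousOn_const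
  have hint : (∮ z : ℂ in C(0, r), (z - 0) ^ k) =
      if k = -1 then 2 * Real.pi * Complex.I else 0 := by
    split_ifs with hk
    · simp only [hk, zpow_neg_one, circleIntegral.integral_sub_center_inv 0 hr.ne']
    · exact circleIntegral.integral_sub_zpow_of_ne hk 0 0 r
  rw [circleIntegral.integral_congr hr.le hsplit, circleIntegral.integral_sub
    (circleIntegrable_zpow_smul_resolvent hr hs _) hone, circleIntegral.integral_smul_const, hint,
    smul_sub, laurentCoeff, ite_smul, zero_smul, smul_ite, smul_zero, smul_smul,
    inv_mul_cancel₀ Complex.two_pi_I_ne_zero, one_smul]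

theorem mul_laurentCoeff (hr : 0 < r) (hs : sphere 0 r ⊆ resolventSet ℂ s) (k : ℤ) :
    s * laurentCoeff s r k = laurentCoeff s r (k + 1) - if k = -1 then 1 else 0 := by
  rw [← circleIntegral_zpow_smul_smul_resolvent_sub_one hr hs, laurentCoeff, mul_smul_comm]
  congr 1
  refine (circleIntegral_comp_comm (ContinuousLinearMap.mul ℂ A s)
    (circleIntegrable_zpow_smul_resolvent hr hs k)).symm.trans ?_
  refine circleIntegral.integral_congr hr.le fun z hz => ?_
  simp only [ContinuousLinearMap.mul_apply', mul_smul_comm, mul_resolvent (hs hz)]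

theorem laurentCoeff_mul (hr : 0 < r) (hs : sphere 0 r ⊆ resolventSet ℂ s) (k : ℤ) :
    laurentCoeff s r k * s = laurentCoeff s r (k + 1) - if k = -1 then 1 else 0 := by
  rw [← circleIntegral_zpow_smul_smul_resolvent_sub_one hr hs, laurentCoeff, smul_mul_assoc]
  congr 1
  refine (circleIntegral_comp_comm ((ContinuousLinearMap.mul ℂ A).flip s)
    (circleIntegrable_zpow_smul_resolvent hr hs k)).symm.trans ?_
  refine circleIntegral.integral_congr hr.le fun z hz => ?_
  simp only [ContinuousLinearMap.flip_apply, ContinuousLinearMap.mul_apply', smul_mul_assoc,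
    resolvent_mul (hs hz)]

theorem exists_norm_laurentCoeff_le (hr : 0 < r) (hs : sphere 0 r ⊆ resolventSet ℂ s) :
    ∃ C : ℝ, ∀ k : ℤ, ‖laurentCoeff s r k‖ ≤ C * r ^ k := by
  have hcont : ContinuousOn (resolvent s) (sphere (0 : ℂ) r) := fun z hz =>
    (spectrum.hasDerivAt_resolvent_const_left (hs hz)).continuousAt.continuousWithinAt
  obtain ⟨C, hC⟩ := (isCompact_sphere (0 : ℂ) r).exists_bound_of_continuousOn hcont
  refine ⟨r * C, fun k => ?_⟩
  refine (circleIntegral.norm_two_pi_i_inv_smul_integral_le_of_norm_le_const (C := r ^ k * C) hr.le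
    fun z hz => ?_).trans_eq (by ring)
  rw [norm_smul, norm_zpow, mem_sphere_zero_iff_norm.mp hz]
  gcongr
  exact hC z hz

end LaurentCoefficients

section DrazinInverse

variable {A : Type*} [NormedRing A]

/-- A generalized Drazin inverse (Koliha) of `s`: an element that inverts `s` outside the spectral
projection `1 - s * c`, on which `s` is quasi-nilpotent. -/
structure IsGeneralizedDrazinInverse (s c : A) : Prop where
  comm : s * c = c * s
  mul_mul_self : c * s * c = c
  decays : DecaysSuperexponentially fun n => s ^ n * (1 - s * c)

theorem IsGeneralizedDrazinInverse.isIdempotentElem_one_sub_mul {s c : A}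
    (h : IsGeneralizedDrazinInverse s c) : IsIdempotentElem (1 - s * c) := by
  refine IsIdempotentElem.one_sub ?_
  rw [IsIdempotentElem, mul_assoc, ← mul_assoc c, h.mul_mul_self]

variable [NormedAlgebra ℂ A] [CompleteSpace A] {s : A} {ρ : ℝ}

theorem decaysSuperexponentially_laurentCoeff (hρ : 0 < ρ)
    (hs : closedBall 0 ρ \ {0} ⊆ resolventSet ℂ s) :
    DecaysSuperexponentially fun n : ℕ => laurentCoeff s ρ n := by
  intro r hr
  have hm : 0 < min r ρ := lt_min hr hρ
  obtain ⟨C, hC⟩ := exists_norm_laurentCoeff_le hm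
    ((sphere_subset_closedBall_diff_singleton hm (min_le_right r ρ)).trans hs)
  refine IsBigO.trans (IsBigO.of_bound C (Eventually.of_forall fun n => ?_))
    (isBigO_pow_pow_of_le_left hm.le (min_le_left r ρ))
  rw [laurentCoeff_eq_of_le hm (min_le_right r ρ) fun z hz =>
    hs ⟨hz.1, fun h0 => hz.2 (h0 ▸ mem_ball_self hm)⟩]
  simpa [abs_of_pos hm] using hC n

theorem pow_mul_laurentCoeff (hρ : 0 < ρ) (hs : sphere 0 ρ ⊆ resolventSet ℂ s) (n : ℕ) :
    s ^ n * laurentCoeff s ρ 0 = laurentCoeff s ρ n := by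
  induction n with
  | zero => simp
  | succ n ih => rw [pow_succ', mul_assoc, ih, mul_laurentCoeff hρ hs, if_neg (by lia)]; simp

theorem pow_mul_laurentCoeff_neg (hρ : 0 < ρ) (hs : sphere 0 ρ ⊆ resolventSet ℂ s) (n : ℕ) :
    s ^ n * laurentCoeff s ρ (-1 - n) = laurentCoeff s ρ (-1) := by
  induction n with
  | zero => simp
  | succ n ih =>
    rw [pow_succ, mul_assoc, mul_laurentCoeff hρ hs, if_neg (by lia), sub_zero, ← ih]
    congr 2
    push_cast
    ring

theorem laurentCoeff_zero_mul_laurentCoeff_neg_one (hρ : 0 < ρ)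
    (hs : closedBall 0 ρ \ {0} ⊆ resolventSet ℂ s) :
    laurentCoeff s ρ 0 * laurentCoeff s ρ (-1) = 0 := by
  have hsphere : sphere 0 ρ ⊆ resolventSet ℂ s :=
    (sphere_subset_closedBall_diff_singleton hρ le_rfl).trans hs
  have hcomm : Commute s (laurentCoeff s ρ 0) := by
    rw [Commute, SemiconjBy, mul_laurentCoeff hρ hsphere, laurentCoeff_mul hρ hsphere]
  obtain ⟨C, hC⟩ := exists_norm_laurentCoeff_le hρ hsphere
  refine (decaysSuperexponentially_laurentCoeff hρ hs).eq_zero_of_norm_le (C := C * ρ⁻¹)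
    (inv_pos.mpr hρ) fun n => ?_
  calc ‖laurentCoeff s ρ 0 * laurentCoeff s ρ (-1)‖
      = ‖laurentCoeff s ρ n * laurentCoeff s ρ (-1 - n)‖ := by
        rw [← pow_mul_laurentCoeff_neg hρ hsphere n, ← pow_mul_laurentCoeff hρ hsphere n,
          (hcomm.pow_left n).eq, mul_assoc]
    _ ≤ ‖laurentCoeff s ρ n‖ * (C * ρ ^ (-1 - n : ℤ)) := by
        grw [norm_mul_le, hC (-1 - n)]
    _ = C * ρ⁻¹ * ρ⁻¹ ^ n * ‖laurentCoeff s ρ n‖ := by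
        rw [zpow_sub₀ hρ.ne', zpow_natCast, zpow_neg_one, inv_pow]
        ring

theorem isGeneralizedDrazinInverse_neg_laurentCoeff (hρ : 0 < ρ)
    (hs : closedBall 0 ρ \ {0} ⊆ resolventSet ℂ s) :
    IsGeneralizedDrazinInverse s (-laurentCoeff s ρ (-1)) := by
  have hsphere : sphere 0 ρ ⊆ resolventSet ℂ s :=
    (sphere_subset_closedBall_diff_singleton hρ le_rfl).trans hs
  have hsc : s * -laurentCoeff s ρ (-1) = 1 - laurentCoeff s ρ 0 := by
    rw [mul_neg, mul_laurentCoeff hρ hsphere, if_pos rfl, neg_sub, neg_add_cancel]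
  have hcs : -laurentCoeff s ρ (-1) * s = 1 - laurentCoeff s ρ 0 := by
    rw [neg_mul, laurentCoeff_mul hρ hsphere, if_pos rfl, neg_sub, neg_add_cancel]
  refine ⟨hsc.trans hcs.symm, ?_, ?_⟩
  · rw [hcs, sub_mul, one_mul, mul_neg, laurentCoeff_zero_mul_laurentCoeff_neg_one hρ hs, neg_zero,
      sub_zero]
  · simpa only [hsc, sub_sub_cancel, pow_mul_laurentCoeff hρ hsphere] using
      decaysSuperexponentially_laurentCoeff hρ hs

theorem exists_isGeneralizedDrazinInverse_sub_smul {a : A} {μ : ℂ}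
    (hμ : ¬ AccPt μ (𝓟 (spectrum ℂ a))) : ∃ c, IsGeneralizedDrazinInverse (a - μ • 1) c := by
  rw [accPt_iff_frequently_nhdsNE, not_frequently, eventually_nhdsWithin_iff,
    nhds_basis_closedBall.eventually_iff] at hμ
  obtain ⟨ρ, hρ, hball⟩ := hμ
  refine ⟨_, isGeneralizedDrazinInverse_neg_laurentCoeff hρ fun z hz => ?_⟩
  have hmem : z + μ ∈ resolventSet ℂ a :=
    not_not.mp (hball (x := z + μ) (by simpa using hz.1) (by simpa using hz.2))
  rw [spectrum.mem_resolventSet_iff] at hmem ⊢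
  convert hmem using 1
  rw [map_add, Algebra.algebraMap_eq_smul_one μ]
  abel

end DrazinInverse

section QuasiNilpotent

variable {A : Type*} [NormedRing A] [NormedAlgebra ℂ A] [CompleteSpace A]

theorem decaysSuperexponentially_pow_iff_spectralRadius_eq_zero {a : A} :
    DecaysSuperexponentially (fun n => a ^ n) ↔ spectralRadius ℂ a = 0 := by
  have gelfand := spectrum.pow_norm_pow_one_div_tendsto_nhds_spectralRadius a
  rw [decaysSuperexponentially_iff_tendsto_rpow]
  refine ⟨fun h => tendsto_nhds_unique gelfand ?_, fun h => ?_⟩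
  · simpa only [ENNReal.ofReal_zero] using ENNReal.tendsto_ofReal h
  · rw [h] at gelfand
    refine ((ENNReal.tendsto_toReal ENNReal.zero_ne_top).comp gelfand).congr fun n => ?_
    exact ENNReal.toReal_ofReal (by positivity)

variable {E : Type*} [NormedAddCommGroup E] [NormedSpace ℂ E] {S : E →L[ℂ] E}

theorem isQuasiNilpotent_iff_spectralRadius_eq_zero :
    IsQuasiNilpotent S ↔ spectralRadius ℂ S = 0 := by
  simp only [IsQuasiNilpotent, spectralRadius, ENNReal.iSup_eq_zero, ENNReal.coe_eq_zero,
    nnnorm_eq_zero, spectrum.mem_iff, Algebra.algebraMap_eq_smul_one, IsUnit.sub_iff (y := S)]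
  exact forall_congr' fun μ => not_imp_comm

theorem isQuasiNilpotent_iff_decaysSuperexponentially [CompleteSpace E] :
    IsQuasiNilpotent S ↔ DecaysSuperexponentially fun n => S ^ n :=
  isQuasiNilpotent_iff_spectralRadius_eq_zero.trans
    decaysSuperexponentially_pow_iff_spectralRadius_eq_zero.symm

end QuasiNilpotent

section LocalSpectralSubspaces

variable {E F : Type*} [NormedAddCommGroup E] [NormedSpace ℂ E] [NormedAddCommGroup F]
  [NormedSpace ℂ F] {S : E →L[ℂ] E} {S' : F →L[ℂ] F}

theorem map_pow_apply (f : E →L[ℂ] F) (hf : ∀ x, f (S x) = S' (f x)) (n : ℕ) (x : E) :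
    f ((S ^ n) x) = (S' ^ n) (f x) := by
  simpa only [FunLike.coe_pow_eq_iterate] using
    Function.Semiconj.iterate_right (f := f) (ga := S) (gb := S') hf n x

theorem mem_quasiNilpotentPart_iff {x : E} :
    x ∈ quasiNilpotentPart S ↔ DecaysSuperexponentially fun n => (S ^ n) x :=
  decaysSuperexponentially_iff_tendsto_rpow.symm

theorem map_mem_quasiNilpotentPart (f : E →L[ℂ] F) (hf : ∀ x, f (S x) = S' (f x)) {x : E}
    (hx : x ∈ quasiNilpotentPart S) : f x ∈ quasiNilpotentPart S' := by
  rw [mem_quasiNilpotentPart_iff] at hx ⊢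
  refine hx.of_norm_le (K := ‖f‖) fun n => ?_
  rw [← map_pow_apply f hf]
  exact f.le_opNorm _

theorem mem_analyticCore_of_backward_orbit {u : ℕ → E} (hu : ∀ n, S (u (n + 1)) = u n) {C R : ℝ}
    (hR : 0 < R) (hbound : ∀ n, ‖u n‖ ≤ C * R ^ n) : u 0 ∈ analyticCore S := by
  rcases eq_or_ne (u 0) 0 with h0 | h0
  · rw [h0]
    exact zero_mem _
  have : 0 < ‖u 0‖ := norm_pos_iff.mpr h0
  have hm : 1 ≤ max 1 (C / ‖u 0‖) := le_max_left _ _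
  refine ⟨max 1 (C / ‖u 0‖) * R, by positivity, u, rfl, hu, fun n => ?_⟩
  rcases n.eq_zero_or_pos with rfl | hn
  · simp
  calc ‖u n‖ ≤ C * R ^ n := hbound n
    _ = C / ‖u 0‖ * R ^ n * ‖u 0‖ := by field_simp
    _ ≤ max 1 (C / ‖u 0‖) ^ n * R ^ n * ‖u 0‖ := by
      gcongr
      exact (le_max_right _ _).trans (le_self_pow₀ hm hn.ne')
    _ = (max 1 (C / ‖u 0‖) * R) ^ n * ‖u 0‖ := by rw [mul_pow]

theorem map_mem_analyticCore (f : E →L[ℂ] F) (hf : ∀ x, f (S x) = S' (f x)) {x : E}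
    (hx : x ∈ analyticCore S) : f x ∈ analyticCore S' := by
  obtain ⟨ε, hε, u, rfl, hu, hbound⟩ := hx
  refine mem_analyticCore_of_backward_orbit (u := fun n => f (u n)) (C := ‖f‖ * ‖u 0‖)
    (fun n => by rw [← hf, hu]) hε fun n => ?_
  calc ‖f (u n)‖ ≤ ‖f‖ * (ε ^ n * ‖u 0‖) := f.le_opNorm_of_le (hbound n)
    _ = ‖f‖ * ‖u 0‖ * ε ^ n := by ring

theorem IsQuasiNilpotent.quasiNilpotentPart_eq_top [CompleteSpace E] (hS : IsQuasiNilpotent S) :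
    quasiNilpotentPart S = ⊤ := by
  refine Submodule.eq_top_iff'.mpr fun x => mem_quasiNilpotentPart_iff.mpr ?_
  refine (isQuasiNilpotent_iff_decaysSuperexponentially.mp hS).of_norm_le (K := ‖x‖) fun n => ?_
  rw [mul_comm]
  exact (S ^ n).le_opNorm x

theorem IsQuasiNilpotent.analyticCore_eq_bot [CompleteSpace E] (hS : IsQuasiNilpotent S) :
    analyticCore S = ⊥ := by
  refine (Submodule.eq_bot_iff _).mpr ?_
  rintro _ ⟨ε, hε, u, rfl, hu, hbound⟩
  have hpow (n : ℕ) : (S ^ n) (u n) = u 0 := by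
    induction n with
    | zero => rfl
    | succ n ih => rw [pow_succ, mul_apply_eq_comp, hu, ih]
  refine (isQuasiNilpotent_iff_decaysSuperexponentially.mp hS).eq_zero_of_norm_le (C := ‖u 0‖) hε
    fun n => ?_
  calc ‖u 0‖ = ‖(S ^ n) (u n)‖ := by rw [hpow]
    _ ≤ ‖S ^ n‖ * (ε ^ n * ‖u 0‖) := (S ^ n).le_opNorm_of_le (hbound n)
    _ = ‖u 0‖ * ε ^ n * ‖S ^ n‖ := by ring

theorem analyticCore_eq_top_of_surjective [CompleteSpace E] (hS : Function.Surjective S) :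
    analyticCore S = ⊤ := by
  obtain ⟨C, hC, hpre⟩ := S.exists_preimage_norm_le hS
  choose g hg hgnorm using hpre
  refine Submodule.eq_top_iff'.mpr fun x => ?_
  refine mem_analyticCore_of_backward_orbit (u := fun n => g^[n] x) (C := ‖x‖)
    (fun n => by rw [Function.iterate_succ_apply', hg]) hC fun n => ?_
  induction n with
  | zero => simp
  | succ n ih =>
    rw [Function.iterate_succ_apply']
    calc ‖g (g^[n] x)‖ ≤ C * (‖x‖ * C ^ n) := by grw [hgnorm, ih]
      _ = ‖x‖ * C ^ (n + 1) := by ring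

theorem quasiNilpotentPart_eq_bot_of_antilipschitzWith {K : NNReal} (hS : AntilipschitzWith K S) :
    quasiNilpotentPart S = ⊥ := by
  refine (Submodule.eq_bot_iff _).mpr fun x hx => ?_
  have hnorm (y : E) : ‖y‖ ≤ (K + 1) * ‖S y‖ := by
    have hK : ‖y‖ ≤ K * ‖S y‖ := by simpa using hS.le_mul_dist y 0
    linarith [norm_nonneg (S y)]
  refine (mem_quasiNilpotentPart_iff.mp hx).eq_zero_of_norm_le (C := 1) (R := K + 1)
    (by positivity) fun n => ?_
  induction n with
  | zero => simp
  | succ n ih =>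
    calc ‖x‖ ≤ 1 * (K + 1) ^ n * ((K + 1) * ‖S ((S ^ n) x)‖) := by grw [ih, hnorm]
      _ = 1 * (K + 1) ^ (n + 1) * ‖(S ^ (n + 1)) x‖ := by
        rw [pow_succ' S, mul_apply_eq_comp]
        ring

end LocalSpectralSubspaces

section Dimension

theorem dim_congr {V W : Type*} [AddCommGroup V] [Module ℂ V] [AddCommGroup W] [Module ℂ W]
    (e : V ≃ₗ[ℂ] W) : dim V = dim W := by
  simpa [dim] using congrArg Cardinal.toENat e.lift_rank_eq

theorem dim_mono {V : Type*} [AddCommGroup V] [Module ℂ V] {p q : Submodule ℂ V} (h : p ≤ q) :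
    dim p ≤ dim q :=
  OrderHomClass.mono Cardinal.toENat (Submodule.rank_mono h)

theorem dim_le_of_injective {V W : Type*} [AddCommGroup V] [Module ℂ V] [AddCommGroup W]
    [Module ℂ W] {f : V →ₗ[ℂ] W} (hf : Function.Injective f) : dim V ≤ dim W :=
  (dim_congr (LinearEquiv.ofInjective f hf)).trans_le <|
    (dim_mono le_top).trans_eq (dim_congr Submodule.topEquiv)

theorem dim_le_of_surjective {V W : Type*} [AddCommGroup V] [Module ℂ V] [AddCommGroup W]
    [Module ℂ W] {f : V →ₗ[ℂ] W} (hf : Function.Surjective f) : dim W ≤ dim V :=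
  have ⟨_, hg⟩ := f.exists_rightInverse_of_surjective (LinearMap.range_eq_top.mpr hf)
  dim_le_of_injective (Function.LeftInverse.injective (LinearMap.congr_fun hg))

theorem finiteDimensional_of_dim_ne_top {V : Type*} [AddCommGroup V] [Module ℂ V]
    (h : dim V ≠ ⊤) : FiniteDimensional ℂ V := by
  rwa [dim, ← lt_top_iff_ne_top, Cardinal.toENat_lt_top, Module.rank_lt_aleph0_iff] at h

theorem exists_submodule_le_dim_eq {V : Type*} [AddCommGroup V] [Module ℂ V] {p : Submodule ℂ V}
    {m : ℕ} (hm : m ≤ dim p) : ∃ q ≤ p, FiniteDimensional ℂ q ∧ dim q = m := by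
  rw [dim, Cardinal.natCast_le_toENat, Module.le_rank_iff_exists_linearMap] at hm
  obtain ⟨f, hf⟩ := hm
  have hinj : Function.Injective (p.subtype ∘ₗ f) := p.injective_subtype.comp hf
  refine ⟨LinearMap.range (p.subtype ∘ₗ f), ?_, inferInstance, ?_⟩
  · rintro _ ⟨c, rfl⟩
    exact (f c).2
  · rw [← dim_congr (LinearEquiv.ofInjective _ hinj)]
    simp [dim]

variable {E F : Type*} [NormedAddCommGroup E] [NormedSpace ℂ E] [NormedAddCommGroup F]
  [NormedSpace ℂ F]

theorem codim_antitone {p q : Submodule ℂ E} (h : p ≤ q) : codim q ≤ codim p :=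
  dim_le_of_surjective (Submodule.factor_surjective h)

theorem codim_comap {f : E →ₗ[ℂ] F} (hf : Function.Surjective f) (p : Submodule ℂ F) :
    codim (p.comap f) = codim p := by
  have hker : LinearMap.ker (p.mkQ ∘ₗ f) = p.comap f := by rw [LinearMap.ker_comp, p.ker_mkQ]
  rw [codim, ← hker]
  exact dim_congr ((p.mkQ ∘ₗ f).quotKerEquivOfSurjective (p.mkQ_surjective.comp hf))

theorem dim_map {V W : Type*} [AddCommGroup V] [Module ℂ V] [AddCommGroup W] [Module ℂ W]
    {f : V →ₗ[ℂ] W} (hf : Function.Injective f) (p : Submodule ℂ V) :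
    dim (p.map f) = dim p :=
  (dim_congr (Submodule.equivMapOfInjective f hf p)).symm

theorem dim_eq_codim_of_isCompl {p q : Submodule ℂ E} (h : IsCompl p q) : dim q = codim p :=
  (dim_congr (Submodule.quotientEquivOfIsCompl p q h)).symm

end Dimension

section OpenConditions

theorem eventually_eq_of_eventually_continuousAt {α β : Type*} [TopologicalSpace α]
    [LocallyConnectedSpace α] [TopologicalSpace β] [TotallyDisconnectedSpace β] {f : α → β}
    {x : α} (hf : ∀ᶠ y in 𝓝 x, ContinuousAt f y) : ∀ᶠ y in 𝓝 x, f y = f x := by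
  obtain ⟨V, hV, hconn, hsub⟩ := locallyConnectedSpace_iff_connected_subsets.mp ‹_› x _ hf
  filter_upwards [hV] with y hy
  exact (hconn.image f (continuousOn_of_forall_continuousAt hsub)).subsingleton
    ⟨y, hy, rfl⟩ ⟨x, mem_of_mem_nhds hV, rfl⟩

variable {E F : Type*} [NormedAddCommGroup E] [NormedSpace ℂ E] [NormedAddCommGroup F]
  [NormedSpace ℂ F]

theorem eventually_surjective [CompleteSpace E] [CompleteSpace F] {D : E →L[ℂ] F}
    (hD : Function.Surjective D) : ∀ᶠ D' : E →L[ℂ] F in 𝓝 D, Function.Surjective D' := by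
  set R := D.nonlinearRightInverseOfSurjective (LinearMap.range_eq_top.mpr hD)
  have hR : 0 < R.nnnorm := D.nonlinearRightInverseOfSurjective_nnnorm_pos _
  filter_upwards [eventually_nnnorm_sub_lt D (inv_pos.mpr hR)] with D' hD'
  have happrox : ApproximatesLinearOn D' D Set.univ ‖D' - D‖₊ :=
    LipschitzOnWith.approximatesLinearOn (D' - D).lipschitz.lipschitzOnWith
  have hopen := happrox.open_image R isOpen_univ (.inr hD')
  rw [Set.image_univ] at hopen
  exact LinearMap.range_eq_top.mp <| Submodule.eq_top_of_nonempty_interior' _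
    ⟨0, hopen.interior_eq.symm ▸ ⟨0, map_zero D'⟩⟩

theorem eventually_antilipschitzWith {K : NNReal} {S : E →L[ℂ] F} (hS : AntilipschitzWith K S) :
    ∀ᶠ S' : E →L[ℂ] F in 𝓝 S, ∃ K', AntilipschitzWith K' S' := by
  have hS : AntilipschitzWith (K + 1) S := fun x y => (hS x y).trans (by gcongr; simp)
  filter_upwards [eventually_nnnorm_sub_lt S (inv_pos.mpr (by positivity : 0 < K + 1))] with S' hS'
  exact ⟨_, hS.add_sub_lipschitzWith (S' - S).lipschitz hS'⟩

theorem eventually_bijective [CompleteSpace E] [CompleteSpace F] {S : E →L[ℂ] F}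
    (hS : Function.Bijective S) : ∀ᶠ S' : E →L[ℂ] F in 𝓝 S, Function.Bijective S' := by
  let e := ContinuousLinearEquiv.ofBijective S (LinearMap.ker_eq_bot.mpr hS.1)
    (LinearMap.range_eq_top.mpr hS.2)
  filter_upwards [ContinuousLinearEquiv.nhds e]
  rintro _ ⟨e', rfl⟩
  exact e'.bijective

theorem tendsto_sub_smul_one (A : E →L[ℂ] E) :
    Tendsto (fun μ : ℂ => A - μ • (1 : E →L[ℂ] E)) (𝓝 0) (𝓝 A) :=
  (continuous_const.sub (continuous_id.smul continuous_const)).tendsto' 0 A (by simp)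

end OpenConditions

section StabilityOfNullity

variable {E V : Type*} [NormedAddCommGroup E] [NormedSpace ℂ E] [NormedAddCommGroup V]
  [NormedSpace ℂ V] {D : E →L[ℂ] E} {Q : E →L[ℂ] V}

theorem dim_le_nullity_of_surjective_prod (h : Function.Surjective (D.prod Q)) :
    dim V ≤ nullity D := by
  refine dim_le_of_surjective (f := Q.toLinearMap ∘ₗ (nullSpace D).subtype) fun v => ?_
  obtain ⟨x, hx⟩ := h (0, v)
  exact ⟨⟨x, congrArg Prod.fst hx⟩, congrArg Prod.snd hx⟩

theorem nullity_le_dim_of_injective_prod (h : Function.Injective (D.prod Q)) :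
    nullity D ≤ dim V := by
  refine dim_le_of_injective (f := Q.toLinearMap ∘ₗ (nullSpace D).subtype) fun x y hxy => ?_
  exact Subtype.ext (h (Prod.ext (x.2.trans y.2.symm) hxy))

variable {W : Submodule ℂ E} {P : E →L[ℂ] W}

theorem surjective_prod_of_le_nullSpace (hD : Function.Surjective D) (hW : W ≤ nullSpace D)
    (hP : ∀ w : W, P w = w) : Function.Surjective (D.prod P) := by
  rintro ⟨y, w⟩
  obtain ⟨x, rfl⟩ := hD y
  have hker (w : W) : D w = 0 := hW w.2
  exact ⟨x - P x + w, by simp [hker, hP]⟩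

theorem injective_prod_of_nullSpace_le (hW : nullSpace D ≤ W) (hP : ∀ w : W, P w = w) :
    Function.Injective (D.prod P) := by
  refine (injective_iff_map_eq_zero _).mpr fun x hx => ?_
  have hPx : P x = 0 := congrArg Prod.snd hx
  simpa only [hPx, ZeroMemClass.coe_zero, eq_comm] using
    congrArg Subtype.val (hP ⟨x, hW (congrArg Prod.fst hx)⟩)

theorem continuousAt_nullity [CompleteSpace E] (hD : Function.Surjective D) :
    ContinuousAt nullity D := by
  have hprod {W : Submodule ℂ E} (P : E →L[ℂ] W) :
      Tendsto (fun D' : E →L[ℂ] E => D'.prod P) (𝓝 D) (𝓝 (D.prod P)) :=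
    ((ContinuousLinearMap.prodₗᵢ ℂ).continuous.comp (Continuous.prodMk_left P)).tendsto D
  by_cases hfin : nullity D = ⊤
  · rw [ContinuousAt, hfin, ENat.tendsto_nhds_top_iff_natCast_lt]
    intro m
    obtain ⟨W, hW, _, hdim⟩ := exists_submodule_le_dim_eq (p := nullSpace D) (m := m + 1)
      (by rw [← nullity, hfin]; exact le_top)
    obtain ⟨P, hP⟩ := Submodule.ClosedComplemented.of_finiteDimensional (𝕜 := ℂ) W
    have : CompleteSpace W := FiniteDimensional.complete ℂ W
    filter_upwards [(hprod P).eventually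
      (eventually_surjective (surjective_prod_of_le_nullSpace hD hW hP))] with D' hD'
    calc (m : ℕ∞) < (m + 1 : ℕ) := by exact_mod_cast m.lt_succ_self
      _ = dim W := hdim.symm
      _ ≤ nullity D' := dim_le_nullity_of_surjective_prod hD'
  · have : FiniteDimensional ℂ (nullSpace D) := finiteDimensional_of_dim_ne_top hfin
    have : CompleteSpace (nullSpace D) := FiniteDimensional.complete ℂ _
    obtain ⟨P, hP⟩ := Submodule.ClosedComplemented.of_finiteDimensional (𝕜 := ℂ) (nullSpace D)
    refine tendsto_nhds_of_eventually_eq ?_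
    filter_upwards [(hprod P).eventually (eventually_bijective
      ⟨injective_prod_of_nullSpace_le le_rfl hP, surjective_prod_of_le_nullSpace hD le_rfl hP⟩)]
      with D' hD'
    exact (nullity_le_dim_of_injective_prod hD'.1).antisymm
      (dim_le_nullity_of_surjective_prod hD'.2)

theorem eventually_nullity_eq [CompleteSpace E] (hD : Function.Surjective D) :
    ∀ᶠ D' in 𝓝 D, nullity D' = nullity D :=
  eventually_eq_of_eventually_continuousAt <|
    (eventually_surjective hD).mono fun _ => continuousAt_nullity

end StabilityOfNullity

section StabilityOfDeficiency

variable {E V : Type*} [NormedAddCommGroup E] [NormedSpace ℂ E] [NormedAddCommGroup V]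
  [NormedSpace ℂ V] {S : E →L[ℂ] E} {J : V →L[ℂ] E}

theorem dim_le_deficiency_of_injective_coprod (h : Function.Injective (S.coprod J)) :
    dim V ≤ deficiency S := by
  refine dim_le_of_injective (f := (rangeSpace S).mkQ ∘ₗ J.toLinearMap) ?_
  refine (injective_iff_map_eq_zero _).mpr fun v hv => ?_
  obtain ⟨x, hx : S x = J v⟩ := (Submodule.Quotient.mk_eq_zero _).mp hv
  have hzero : S.coprod J (-x, v) = S.coprod J 0 := by simp [hx]
  exact congrArg Prod.snd (h hzero)

theorem deficiency_le_dim_of_surjective_coprod (h : Function.Surjective (S.coprod J)) :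
    deficiency S ≤ dim V := by
  refine dim_le_of_surjective (f := (rangeSpace S).mkQ ∘ₗ J.toLinearMap) fun q => ?_
  obtain ⟨y, rfl⟩ := (rangeSpace S).mkQ_surjective q
  obtain ⟨⟨x, v⟩, rfl⟩ := h y
  exact ⟨v, (Submodule.Quotient.eq _).mpr ⟨-x, by simp⟩⟩

variable {W : Submodule ℂ E}

theorem injective_coprod_of_disjoint (hS : Function.Injective S)
    (hW : Disjoint (rangeSpace S) W) : Function.Injective (S.coprod W.subtypeL) := by
  refine (injective_iff_map_eq_zero _).mpr ?_
  rintro ⟨x, w⟩ hxw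
  replace hxw : S x + w = 0 := hxw
  have hw : (w : E) = 0 := Submodule.disjoint_def.mp hW w
    ⟨-x, by simp [neg_eq_of_add_eq_zero_right hxw]⟩ w.2
  rw [hw, add_zero] at hxw
  exact Prod.ext (hS (hxw.trans (map_zero S).symm)) (Subtype.ext hw)

theorem range_coprod_subtypeL :
    LinearMap.range (S.coprod W.subtypeL).toLinearMap = rangeSpace S ⊔ W := by
  rw [ContinuousLinearMap.coe_coprod, LinearMap.range_coprod, Submodule.toLinearMap_subtypeL,
    Submodule.range_subtype, rangeSpace]

theorem surjective_coprod_of_codisjoint (hW : Codisjoint (rangeSpace S) W) :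
    Function.Surjective (S.coprod W.subtypeL) :=
  LinearMap.range_eq_top.mp (range_coprod_subtypeL.trans hW.eq_top)

theorem isClosed_range_coprod_subtypeL [FiniteDimensional ℂ W]
    (hS : IsClosed (rangeSpace S : Set E)) : IsClosed (Set.range (S.coprod W.subtypeL)) := by
  change IsClosed (LinearMap.range (S.coprod W.subtypeL).toLinearMap : Set E)
  rw [range_coprod_subtypeL]
  exact Submodule.isClosed_sup_finiteDimensional _ _ hS

theorem continuousAt_deficiency [CompleteSpace E] {K : NNReal} (hS : AntilipschitzWith K S) :
    ContinuousAt deficiency S := by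
  have hcoprod (W : Submodule ℂ E) :
      Tendsto (fun S' : E →L[ℂ] E => S'.coprod W.subtypeL) (𝓝 S) (𝓝 (S.coprod W.subtypeL)) :=
    (by fun_prop : Continuous fun S' : E →L[ℂ] E => S'.coprod W.subtypeL).tendsto S
  obtain ⟨C, hC⟩ := (rangeSpace S).exists_isCompl
  have hdimC : dim C = deficiency S := dim_eq_codim_of_isCompl hC
  by_cases hfin : deficiency S = ⊤
  · rw [ContinuousAt, hfin, ENat.tendsto_nhds_top_iff_natCast_lt]
    intro m
    obtain ⟨W, hW, _, hdim⟩ := exists_submodule_le_dim_eq (p := C) (m := m + 1)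
      (by rw [hdimC, hfin]; exact le_top)
    have : CompleteSpace W := FiniteDimensional.complete ℂ W
    have hclosed : IsClosed (Set.range (S.coprod W.subtypeL)) :=
      isClosed_range_coprod_subtypeL (hS.isClosed_range S.uniformContinuous)
    obtain ⟨K', hK'⟩ := (S.coprod W.subtypeL).antilipschitz_of_injective_of_isClosed_range
      (injective_coprod_of_disjoint hS.injective (hC.disjoint.mono_right hW)) hclosed
    filter_upwards [(hcoprod W).eventually (eventually_antilipschitzWith hK')] with S' ⟨_, hS'⟩
    calc (m : ℕ∞) < (m + 1 : ℕ) := by exact_mod_cast m.lt_succ_self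
      _ = dim W := hdim.symm
      _ ≤ deficiency S' := dim_le_deficiency_of_injective_coprod hS'.injective
  · have : FiniteDimensional ℂ C := finiteDimensional_of_dim_ne_top (hdimC ▸ hfin)
    have : CompleteSpace C := FiniteDimensional.complete ℂ C
    refine tendsto_nhds_of_eventually_eq ?_
    filter_upwards [(hcoprod C).eventually (eventually_bijective
      ⟨injective_coprod_of_disjoint hS.injective hC.disjoint,
        surjective_coprod_of_codisjoint hC.codisjoint⟩)] with S' hS'
    rw [← hdimC]
    exact (deficiency_le_dim_of_surjective_coprod hS'.2).antisymm
      (dim_le_deficiency_of_injective_coprod hS'.1)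

theorem eventually_deficiency_eq [CompleteSpace E] {K : NNReal} (hS : AntilipschitzWith K S) :
    ∀ᶠ S' in 𝓝 S, deficiency S' = deficiency S :=
  eventually_eq_of_eventually_continuousAt <|
    (eventually_antilipschitzWith hS).mono fun _ ⟨_, h⟩ => continuousAt_deficiency h

end StabilityOfDeficiency

section SemiRegular

variable {E : Type*} [NormedAddCommGroup E] [NormedSpace ℂ E] {S : E →L[ℂ] E}

theorem mem_rangeSpace_pow_succ {n : ℕ} {y : E} :
    y ∈ rangeSpace (S ^ (n + 1)) ↔ ∃ x ∈ rangeSpace (S ^ n), S x = y := by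
  rw [pow_succ']
  constructor
  · rintro ⟨z, rfl⟩
    exact ⟨(S ^ n) z, ⟨z, rfl⟩, rfl⟩
  · rintro ⟨_, ⟨z, rfl⟩, rfl⟩
    exact ⟨z, rfl⟩

theorem rangeSpace_pow_succ_le (n : ℕ) : rangeSpace (S ^ (n + 1)) ≤ rangeSpace (S ^ n) := by
  rintro _ ⟨z, rfl⟩
  exact ⟨S z, by rw [pow_succ]; rfl⟩

/-- The hyper-range `R^∞(S) = ⋂ₙ R(Sⁿ)`. A semi-regular `S` maps it onto itself and is bounded
below modulo it. -/
def hyperRange (S : E →L[ℂ] E) : Submodule ℂ E :=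
  ⨅ n : ℕ, rangeSpace (S ^ n)

theorem mem_hyperRange_iff {x : E} : x ∈ hyperRange S ↔ ∀ n : ℕ, x ∈ rangeSpace (S ^ n) :=
  Submodule.mem_iInf _

namespace IsSemiRegular

theorem apply_mem_rangeSpace_pow_succ_iff (hS : IsSemiRegular S) {n : ℕ} {x : E} :
    S x ∈ rangeSpace (S ^ (n + 1)) ↔ x ∈ rangeSpace (S ^ n) := by
  rw [mem_rangeSpace_pow_succ]
  refine ⟨?_, fun hx => ⟨x, hx, rfl⟩⟩
  rintro ⟨y, hy, hyx⟩
  have hker : x - y ∈ nullSpace S := LinearMap.sub_mem_ker_iff.mpr hyx.symm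
  simpa only [sub_add_cancel] using add_mem (hS.2 n hker) hy

theorem isClosed_rangeSpace_pow [CompleteSpace E] (hS : IsSemiRegular S) (n : ℕ) :
    IsClosed (rangeSpace (S ^ n) : Set E) := by
  induction n with
  | zero =>
    have htop : rangeSpace (S ^ 0) = ⊤ := LinearMap.range_eq_top.mpr Function.surjective_id
    rw [htop]
    exact isClosed_univ
  | succ n ih =>
    have : CompleteSpace (rangeSpace S) := hS.1.completeSpace_coe
    let f : E →L[ℂ] rangeSpace S := S.codRestrict (rangeSpace S) fun x => ⟨x, rfl⟩
    have hf : Function.Surjective f := fun ⟨_, x, hx⟩ => ⟨x, Subtype.ext hx⟩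
    have hclosed : IsClosed {z : rangeSpace S | (z : E) ∈ rangeSpace (S ^ (n + 1))} := by
      rw [← (f.isQuotientMap hf).isClosed_preimage]
      convert ih using 1
      ext x
      exact hS.apply_mem_rangeSpace_pow_succ_iff
    convert hS.1.isClosedEmbedding_subtypeVal.isClosedMap _ hclosed using 1
    ext y
    refine ⟨fun hy => ?_, ?_⟩
    · obtain ⟨x, -, rfl⟩ := mem_rangeSpace_pow_succ.mp hy
      exact ⟨⟨S x, x, rfl⟩, hy, rfl⟩
    · rintro ⟨z, hz, rfl⟩
      exact hz

theorem isClosed_hyperRange [CompleteSpace E] (hS : IsSemiRegular S) :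
    IsClosed (hyperRange S : Set E) := by
  rw [hyperRange, Submodule.coe_iInf]
  exact isClosed_iInter hS.isClosed_rangeSpace_pow

theorem apply_mem_hyperRange_iff (hS : IsSemiRegular S) {x : E} :
    S x ∈ hyperRange S ↔ x ∈ hyperRange S := by
  simp only [mem_hyperRange_iff]
  refine ⟨fun h n => hS.apply_mem_rangeSpace_pow_succ_iff.mp (h (n + 1)), fun h n => ?_⟩
  exact rangeSpace_pow_succ_le n (hS.apply_mem_rangeSpace_pow_succ_iff.mpr (h n))

theorem exists_mem_hyperRange_apply_eq (hS : IsSemiRegular S) {y : E} (hy : y ∈ hyperRange S) :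
    ∃ x ∈ hyperRange S, S x = y := by
  obtain ⟨x, -, rfl⟩ := mem_rangeSpace_pow_succ.mp (mem_hyperRange_iff.mp hy 1)
  exact ⟨x, hS.apply_mem_hyperRange_iff.mp hy, rfl⟩

end IsSemiRegular

section Triangular

/-- The closed subspace `K` is `S`-invariant, `D` is the restriction of `S` to `K` and `Q` is the
operator induced by `S` on `E ⧸ K`: the diagonal entries of `S` in block triangular form. -/
structure IsTriangular (S : E →L[ℂ] E) (K : Submodule ℂ E) [IsClosed (K : Set E)]
    (D : K →L[ℂ] K) (Q : (E ⧸ K) →L[ℂ] (E ⧸ K)) : Prop where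
  coe_apply : ∀ k : K, (D k : E) = S k
  mk_apply : ∀ x : E, Q (K.mkQL x) = K.mkQL (S x)

namespace IsTriangular

variable {K : Submodule ℂ E} [IsClosed (K : Set E)] {D : K →L[ℂ] K} {Q : (E ⧸ K) →L[ℂ] (E ⧸ K)}

theorem sub_smul_one (h : IsTriangular S K D Q) (μ : ℂ) :
    IsTriangular (S - μ • 1) K (D - μ • 1) (Q - μ • 1) where
  coe_apply k := by simp [h.coe_apply]
  mk_apply x := by
    change Q (K.mkQL x) - μ • K.mkQL x = K.mkQL (S x - μ • x)
    rw [map_sub, map_smul, h.mk_apply]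

theorem nullSpace_le (h : IsTriangular S K D Q) (hQ : Function.Injective Q) : nullSpace S ≤ K := by
  intro x (hx : S x = 0)
  refine (Submodule.Quotient.mk_eq_zero K).mp (hQ ?_)
  rw [map_zero]
  exact (h.mk_apply x).trans (hx ▸ map_zero K.mkQL)

theorem le_rangeSpace_pow (h : IsTriangular S K D Q) (hD : Function.Surjective D) (n : ℕ) :
    K ≤ rangeSpace (S ^ n) := by
  induction n with
  | zero => exact fun x _ => ⟨x, rfl⟩
  | succ n ih =>
    intro y hy
    obtain ⟨x, hx⟩ := hD ⟨y, hy⟩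
    exact mem_rangeSpace_pow_succ.mpr ⟨x, ih x.2, by rw [← h.coe_apply, hx]⟩

theorem rangeSpace_eq_comap (h : IsTriangular S K D Q) (hD : Function.Surjective D) :
    rangeSpace S = (rangeSpace Q).comap K.mkQ := by
  ext y
  constructor
  · rintro ⟨x, rfl⟩
    exact ⟨K.mkQL x, h.mk_apply x⟩
  · rintro ⟨q, hq⟩
    obtain ⟨x, rfl⟩ := K.mkQ_surjective q
    have hmem : y - S x ∈ K := (Submodule.Quotient.eq K).mp (hq.symm.trans (h.mk_apply x))
    obtain ⟨z, hz⟩ := hD ⟨_, hmem⟩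
    have hSz : S z = y - S x := by rw [← h.coe_apply, hz]
    exact ⟨z + x, (map_add S _ _).trans (by rw [hSz, sub_add_cancel])⟩

theorem nullity_eq (h : IsTriangular S K D Q) (hQ : Function.Injective Q) :
    nullity S = nullity D := by
  have hker : nullSpace D = (nullSpace S).comap K.subtype := by
    ext k
    change D k = 0 ↔ S k = 0
    rw [← h.coe_apply, ← ZeroMemClass.coe_zero K, Subtype.ext_iff]
  rw [nullity, nullity, hker]
  exact (dim_congr (Submodule.comapSubtypeEquivOfLe (h.nullSpace_le hQ))).symm

theorem deficiency_eq (h : IsTriangular S K D Q) (hD : Function.Surjective D) :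
    deficiency S = deficiency Q := by
  rw [deficiency, deficiency, h.rangeSpace_eq_comap hD, codim_comap K.mkQ_surjective]

theorem isSemiRegular [CompleteSpace E] {C : NNReal} (h : IsTriangular S K D Q)
    (hD : Function.Surjective D) (hQ : AntilipschitzWith C Q) : IsSemiRegular S := by
  refine ⟨?_, fun n => (h.nullSpace_le hQ.injective).trans (h.le_rangeSpace_pow hD n)⟩
  rw [h.rangeSpace_eq_comap hD]
  exact (hQ.isClosed_range Q.uniformContinuous).preimage K.mkQL.continuous

theorem le_analyticCore [CompleteSpace E] (h : IsTriangular S K D Q)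
    (hD : Function.Surjective D) : K ≤ analyticCore S := by
  have : CompleteSpace K := IsClosed.completeSpace_coe (s := (K : Set E))
  intro x hx
  have hxD : (⟨x, hx⟩ : K) ∈ analyticCore D := by
    rw [analyticCore_eq_top_of_surjective hD]
    trivial
  exact map_mem_analyticCore K.subtypeL h.coe_apply hxD

theorem quasiNilpotentPart_le {C : NNReal} (h : IsTriangular S K D Q)
    (hQ : AntilipschitzWith C Q) : quasiNilpotentPart S ≤ K := by
  intro x hx
  have hxQ := map_mem_quasiNilpotentPart K.mkQL (fun x => (h.mk_apply x).symm) hx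
  rw [quasiNilpotentPart_eq_bot_of_antilipschitzWith hQ] at hxQ
  exact (Submodule.Quotient.mk_eq_zero K).mp hxQ

end IsTriangular

end Triangular

namespace IsSemiRegular

theorem exists_isTriangular_hyperRange [CompleteSpace E] (hS : IsSemiRegular S)
    [IsClosed (hyperRange S : Set E)] :
    ∃ D Q, IsTriangular S (hyperRange S) D Q ∧ Function.Surjective D ∧
      ∃ C, AntilipschitzWith C Q := by
  set K := hyperRange S
  have hinv : ∀ x ∈ K, S x ∈ K := fun x hx => hS.apply_mem_hyperRange_iff.mpr hx
  let D : K →L[ℂ] K := S.restrict hinv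
  let Q : (E ⧸ K) →L[ℂ] (E ⧸ K) := K.liftQL (K.mkQL.comp S) fun x hx =>
    (Submodule.Quotient.mk_eq_zero K).mpr (hinv x hx)
  have h : IsTriangular S K D Q := ⟨fun _ => rfl, fun _ => rfl⟩
  have hD : Function.Surjective D := by
    rintro ⟨y, hy⟩
    obtain ⟨x, hx, rfl⟩ := hS.exists_mem_hyperRange_apply_eq hy
    exact ⟨⟨x, hx⟩, rfl⟩
  have hQ : Function.Injective Q := by
    refine (injective_iff_map_eq_zero Q).mpr fun q hq => ?_
    obtain ⟨x, rfl⟩ := K.mkQ_surjective q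
    exact (Submodule.Quotient.mk_eq_zero K).mpr
      (hS.apply_mem_hyperRange_iff.mp ((Submodule.Quotient.mk_eq_zero K).mp hq))
  have hclosed : IsClosed (Set.range Q) := by
    have hrange := hS.1
    rw [h.rangeSpace_eq_comap hD] at hrange
    exact K.isQuotientMap_mkQL.isClosed_preimage.mp hrange
  exact ⟨D, Q, h, hD, Q.antilipschitz_of_injective_of_isClosed_range hQ hclosed⟩

theorem nullSpace_le_analyticCore [CompleteSpace E] (hS : IsSemiRegular S) :
    nullSpace S ≤ analyticCore S := by
  have : IsClosed (hyperRange S : Set E) := hS.isClosed_hyperRange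
  obtain ⟨D, Q, h, hD, C, hQ⟩ := hS.exists_isTriangular_hyperRange
  exact (h.nullSpace_le hQ.injective).trans (h.le_analyticCore hD)

theorem quasiNilpotentPart_le_rangeSpace [CompleteSpace E] (hS : IsSemiRegular S) :
    quasiNilpotentPart S ≤ rangeSpace S := by
  have : IsClosed (hyperRange S : Set E) := hS.isClosed_hyperRange
  obtain ⟨D, Q, h, hD, C, hQ⟩ := hS.exists_isTriangular_hyperRange
  simpa only [pow_one] using (h.quasiNilpotentPart_le hQ).trans (h.le_rangeSpace_pow hD 1)

theorem eventually_sub_smul_one [CompleteSpace E] (hS : IsSemiRegular S) :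
    ∀ᶠ μ : ℂ in 𝓝 0, IsSemiRegular (S - μ • 1) ∧ nullity (S - μ • 1) = nullity S ∧
      deficiency (S - μ • 1) = deficiency S := by
  have hclosed : IsClosed (hyperRange S : Set E) := hS.isClosed_hyperRange
  have : CompleteSpace (hyperRange S) := hclosed.completeSpace_coe
  obtain ⟨D, Q, h, hD, C, hQ⟩ := hS.exists_isTriangular_hyperRange
  filter_upwards [(tendsto_sub_smul_one D).eventually (eventually_surjective hD),
    (tendsto_sub_smul_one D).eventually (eventually_nullity_eq hD),
    (tendsto_sub_smul_one Q).eventually (eventually_antilipschitzWith hQ),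
    (tendsto_sub_smul_one Q).eventually (eventually_deficiency_eq hQ)]
    with μ hDμ hnullity ⟨_, hQμ⟩ hdeficiency
  have hμ := h.sub_smul_one μ
  refine ⟨hμ.isSemiRegular hDμ hQμ, ?_, ?_⟩
  · rw [hμ.nullity_eq hQμ.injective, hnullity, h.nullity_eq hQ.injective]
  · rw [hμ.deficiency_eq hDμ, hdeficiency, h.deficiency_eq hD]

end IsSemiRegular

end SemiRegular

section ReducingPairs

variable {X : Type*} [NormedAddCommGroup X] [NormedSpace ℂ X] {S : X →L[ℂ] X}
  {M N : Submodule ℂ X}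

theorem IsRed.symm (h : IsRed S M N) : IsRed S N M :=
  ⟨h.isClosed_right, h.isClosed_left, h.invariant_right, h.invariant_left, h.isCompl.symm⟩

theorem isRed_of_isIdempotentElem {P : X →L[ℂ] X} (hP : IsIdempotentElem P)
    (hcomm : Commute P S) : IsRed S (nullSpace P) (rangeSpace P) where
  isClosed_left := P.isClosed_ker
  isClosed_right := (ContinuousLinearMap.IsIdempotentElem.isTopCompl hP).isClosed
  invariant_left x (hx : P x = 0) := show P (S x) = 0 by
    rw [← mul_apply_eq_comp, hcomm.eq, mul_apply_eq_comp, hx, map_zero]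
  invariant_right := by
    rintro _ ⟨x, rfl⟩
    exact ⟨S x, DFunLike.congr_fun hcomm.eq x⟩
  isCompl := (ContinuousLinearMap.IsIdempotentElem.isTopCompl hP).isCompl.symm

variable [CompleteSpace X]

theorem IsRed.isTopCompl (h : IsRed S M N) : Submodule.IsTopCompl M N :=
  Submodule.IsCompl.isTopCompl_of_isClosed h.isCompl h.isClosed_left h.isClosed_right

/-- The projection of `X` onto the first component `M` of a reducing pair `(M, N)`, along `N`. -/
noncomputable def IsRed.proj (h : IsRed S M N) : X →L[ℂ] M :=
  M.projectionOntoL N h.isTopCompl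

theorem IsRed.proj_coe (h : IsRed S M N) (m : M) : h.proj m = m :=
  M.projectionOntoL_apply_left h.isTopCompl m

theorem IsRed.proj_surjective (h : IsRed S M N) : Function.Surjective h.proj :=
  fun m => ⟨m, h.proj_coe m⟩

theorem IsRed.proj_add_proj_symm (h : IsRed S M N) (x : X) :
    (h.proj x : X) + h.symm.proj x = x :=
  DFunLike.congr_fun (Submodule.projectionL_add_projectionL_eq_id h.isTopCompl) x

theorem IsRed.proj_symm_coe (h : IsRed S M N) (m : M) : h.symm.proj m = 0 :=
  N.projectionOntoL_apply_right h.isTopCompl.symm m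

theorem IsRed.proj_apply (h : IsRed S M N) (x : X) :
    h.proj (S x) = restr S M h.invariant_left (h.proj x) := by
  have hM : S (h.proj x) = (restr S M h.invariant_left (h.proj x) : M) := rfl
  have hN : S (h.symm.proj x) = (restr S N h.invariant_right (h.symm.proj x) : N) := rfl
  conv_lhs => rw [← h.proj_add_proj_symm x, map_add, map_add, hM, hN, h.proj_coe,
    h.symm.proj_symm_coe, add_zero]

end ReducingPairs

section PseudoFredholmDecompositions

variable {X : Type*} [NormedAddCommGroup X] [NormedSpace ℂ X] [CompleteSpace X] {S : X →L[ℂ] X}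
  {M N : Submodule ℂ X}

theorem IsGKD.nullSpace_inf_analyticCore (h : IsGKD S M N) :
    nullSpace S ⊓ analyticCore S = (nullSpace (restr S M h.invariant_left)).map M.subtype := by
  have : CompleteSpace M := h.isClosed_left.completeSpace_coe
  have : CompleteSpace N := h.isClosed_right.completeSpace_coe
  refine le_antisymm ?_ (Submodule.map_le_iff_le_comap.mpr fun m hm =>
    ⟨congrArg Subtype.val hm, map_mem_analyticCore M.subtypeL (fun _ => rfl)
      (h.semiRegular.nullSpace_le_analyticCore hm)⟩)
  rintro x ⟨hx, hxK⟩
  have hN : h.symm.proj x = 0 := by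
    have hmem := map_mem_analyticCore h.symm.proj h.symm.proj_apply hxK
    rwa [h.quasiNilpotent.analyticCore_eq_bot, Submodule.mem_bot] at hmem
  have hM : restr S M h.invariant_left (h.proj x) = 0 := by
    rw [← h.proj_apply, show S x = 0 from hx, map_zero]
  refine ⟨h.proj x, hM, ?_⟩
  simpa only [hN, Submodule.coe_zero, add_zero, Submodule.subtype_apply] using
    h.proj_add_proj_symm x

theorem IsGKD.rangeSpace_sup_quasiNilpotentPart (h : IsGKD S M N) :
    rangeSpace S ⊔ quasiNilpotentPart S =
      (rangeSpace (restr S M h.invariant_left)).comap (h.proj : X →ₗ[ℂ] M) := by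
  have : CompleteSpace M := h.isClosed_left.completeSpace_coe
  have : CompleteSpace N := h.isClosed_right.completeSpace_coe
  refine le_antisymm (sup_le ?_ fun x hx => ?_) fun x hx => ?_
  · rintro _ ⟨x, rfl⟩
    exact ⟨h.proj x, (h.proj_apply x).symm⟩
  · exact h.semiRegular.quasiNilpotentPart_le_rangeSpace
      (map_mem_quasiNilpotentPart h.proj h.proj_apply hx)
  · obtain ⟨m, hm⟩ := hx
    have hM : S m = h.proj x := congrArg Subtype.val hm
    have hN : (h.symm.proj x : X) ∈ quasiNilpotentPart S := by
      refine map_mem_quasiNilpotentPart N.subtypeL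
        (S := restr S N h.invariant_right) (fun _ => rfl) ?_
      rw [h.quasiNilpotent.quasiNilpotentPart_eq_top]
      exact Submodule.mem_top
    rw [← h.proj_add_proj_symm x, ← hM]
    exact Submodule.add_mem_sup ⟨m, rfl⟩ hN

theorem IsGKD.nullity_restr (h : IsGKD S M N) :
    nullity (restr S M h.invariant_left) = dim ↥(nullSpace S ⊓ analyticCore S) := by
  rw [h.nullSpace_inf_analyticCore, dim_map M.subtype_injective, nullity]

theorem IsGKD.deficiency_restr (h : IsGKD S M N) :
    deficiency (restr S M h.invariant_left) = codim (rangeSpace S ⊔ quasiNilpotentPart S) := by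
  rw [h.rangeSpace_sup_quasiNilpotentPart, codim_comap h.proj_surjective, deficiency]

end PseudoFredholmDecompositions

section InvertibleExtensions

variable {E F : Type*} [NormedAddCommGroup E] [NormedSpace ℂ E] [NormedAddCommGroup F]
  [NormedSpace ℂ F]

/-- `S` is the direct sum of `A` and an invertible operator: `i` and `q` are the inclusion and the
projection of the summand on which `S` acts as `A`, and `c` inverts `S` on `ker q`. -/
structure IsInvertibleExtension (S : E →L[ℂ] E) (A : F →L[ℂ] F) (i : F →L[ℂ] E) (q : E →L[ℂ] F)
    (c : E →L[ℂ] E) : Prop where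
  proj_incl (m : F) : q (i m) = m
  incl_apply (m : F) : i (A m) = S (i m)
  proj_apply (x : E) : q (S x) = A (q x)
  apply_inv (x : E) : S (c x) = x - i (q x)
  inv_apply (x : E) : c (S x) = x - i (q x)

namespace IsInvertibleExtension

variable {S : E →L[ℂ] E} {A : F →L[ℂ] F} {i : F →L[ℂ] E} {q : E →L[ℂ] F} {c : E →L[ℂ] E}

theorem nullSpace_eq (h : IsInvertibleExtension S A i q c) :
    nullSpace S = (nullSpace A).map (i : F →ₗ[ℂ] E) := by
  refine le_antisymm (fun x hx => ?_) (Submodule.map_le_iff_le_comap.mpr fun m hm => ?_)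
  · have hx : S x = 0 := hx
    refine ⟨q x, ?_, ?_⟩
    · exact (h.proj_apply x).symm.trans (by rw [hx, map_zero])
    · have hinv := h.inv_apply x
      rw [hx, map_zero] at hinv
      exact (sub_eq_zero.mp hinv.symm).symm
  · have hm : A m = 0 := hm
    exact (h.incl_apply m).symm.trans (by rw [hm, map_zero])

theorem rangeSpace_eq (h : IsInvertibleExtension S A i q c) :
    rangeSpace S = (rangeSpace A).comap (q : E →ₗ[ℂ] F) := by
  refine le_antisymm ?_ fun x hx => ?_
  · rintro _ ⟨x, rfl⟩
    exact ⟨q x, (h.proj_apply x).symm⟩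
  · obtain ⟨m, hm⟩ := hx
    have hm : A m = q x := hm
    exact ⟨i m + c x, show S (i m + c x) = x by
      rw [map_add, ← h.incl_apply, hm, h.apply_inv, add_sub_cancel]⟩

theorem isSemiRegular (h : IsInvertibleExtension S A i q c) (hA : IsSemiRegular A) :
    IsSemiRegular S := by
  refine ⟨?_, fun n => ?_⟩
  · rw [h.rangeSpace_eq]
    exact hA.1.preimage q.continuous
  · rw [h.nullSpace_eq, Submodule.map_le_iff_le_comap]
    intro m hm
    obtain ⟨y, rfl⟩ := hA.2 n hm
    exact ⟨i y, (map_pow_apply i h.incl_apply n y).symm⟩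

theorem nullity_eq (h : IsInvertibleExtension S A i q c) : nullity S = nullity A := by
  have hi : Function.Injective i := Function.LeftInverse.injective h.proj_incl
  rw [nullity, h.nullSpace_eq, dim_map hi, nullity]

theorem deficiency_eq (h : IsInvertibleExtension S A i q c) : deficiency S = deficiency A := by
  have hq : Function.Surjective q := Function.RightInverse.surjective h.proj_incl
  rw [deficiency, h.rangeSpace_eq, codim_comap hq, deficiency]

end IsInvertibleExtension

end InvertibleExtensions

section DrazinSplitting

variable {X : Type*} [NormedAddCommGroup X] [NormedSpace ℂ X] [CompleteSpace X] {S : X →L[ℂ] X}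
  {M N : Submodule ℂ X}

/-- For a reducing pair `(M, N)` and a generalized Drazin inverse `c` of `S_N`, the projection of
`X` onto the part of `N` on which `S` is quasi-nilpotent. -/
noncomputable def IsRed.drazinProj (h : IsRed S M N) (c : N →L[ℂ] N) : X →L[ℂ] X :=
  N.subtypeL ∘L (1 - restr S N h.invariant_right * c) ∘L h.symm.proj

variable {c : N →L[ℂ] N}

theorem IsRed.drazinProj_apply (h : IsRed S M N) (x : X) : h.drazinProj c x =
    ((1 - restr S N h.invariant_right * c) (h.symm.proj x) : N) :=
  rfl

theorem IsRed.isIdempotentElem_drazinProj (h : IsRed S M N)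
    (hc : IsGeneralizedDrazinInverse (restr S N h.invariant_right) c) :
    IsIdempotentElem (h.drazinProj c) := by
  refine ContinuousLinearMap.ext fun x => ?_
  rw [mul_apply_eq_comp, h.drazinProj_apply, h.drazinProj_apply, h.symm.proj_coe,
    ← mul_apply_eq_comp, hc.isIdempotentElem_one_sub_mul.eq]

theorem IsRed.commute_drazinProj (h : IsRed S M N)
    (hc : IsGeneralizedDrazinInverse (restr S N h.invariant_right) c) :
    Commute (h.drazinProj c) S := by
  have hcomm : Commute (1 - restr S N h.invariant_right * c) (restr S N h.invariant_right) :=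
    (Commute.one_left _).sub_left ((Commute.refl _).mul_left hc.comm.symm)
  refine ContinuousLinearMap.ext fun x => ?_
  rw [mul_apply_eq_comp, mul_apply_eq_comp, h.drazinProj_apply, h.drazinProj_apply,
    h.symm.proj_apply, ← mul_apply_eq_comp, hcomm.eq]
  rfl

theorem IsRed.isRed_drazinProj (h : IsRed S M N)
    (hc : IsGeneralizedDrazinInverse (restr S N h.invariant_right) c) :
    IsRed S (nullSpace (h.drazinProj c)) (rangeSpace (h.drazinProj c)) :=
  isRed_of_isIdempotentElem (h.isIdempotentElem_drazinProj hc) (h.commute_drazinProj hc)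

theorem IsRed.isQuasiNilpotent_restr_range_drazinProj (h : IsRed S M N)
    (hc : IsGeneralizedDrazinInverse (restr S N h.invariant_right) c) :
    IsQuasiNilpotent (restr S _ (h.isRed_drazinProj hc).invariant_right) := by
  set Y := rangeSpace (h.drazinProj c)
  have hred := h.isRed_drazinProj hc
  set B := restr S N h.invariant_right
  have : CompleteSpace Y := hred.isClosed_right.completeSpace_coe
  refine isQuasiNilpotent_iff_decaysSuperexponentially.mpr
    (hc.decays.of_norm_le (K := ‖h.symm.proj‖) fun n => ?_)
  refine ContinuousLinearMap.opNorm_le_bound _ (by positivity) fun y => ?_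
  have hy : h.drazinProj c y = y := by
    obtain ⟨_, x, rfl⟩ := y
    exact DFunLike.congr_fun (h.isIdempotentElem_drazinProj hc).eq x
  have hpow : (((restr S Y hred.invariant_right ^ n) y : Y) : X) =
      ((B ^ n * (1 - B * c)) (h.symm.proj y) : N) := by
    calc (((restr S Y hred.invariant_right ^ n) y : Y) : X) = (S ^ n) y :=
          map_pow_apply Y.subtypeL (fun _ => rfl) n y
      _ = (S ^ n) ((1 - B * c) (h.symm.proj y) : N) := by rw [← h.drazinProj_apply, hy]
      _ = ((B ^ n * (1 - B * c)) (h.symm.proj y) : N) :=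
          (map_pow_apply N.subtypeL (S := B) (fun _ => rfl) n ((1 - B * c) (h.symm.proj y))).symm
  calc ‖(restr S Y hred.invariant_right ^ n) y‖
      = ‖(B ^ n * (1 - B * c)) (h.symm.proj y)‖ := congrArg norm hpow
    _ ≤ ‖B ^ n * (1 - B * c)‖ * (‖h.symm.proj‖ * ‖y‖) :=
        (B ^ n * (1 - B * c)).le_opNorm_of_le (h.symm.proj.le_opNorm _)
    _ = ‖h.symm.proj‖ * ‖B ^ n * (1 - B * c)‖ * ‖y‖ := by ring

theorem IsRed.mem_nullSpace_drazinProj_iff (h : IsRed S M N) {x : X} :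
    x ∈ nullSpace (h.drazinProj c) ↔
      restr S N h.invariant_right (c (h.symm.proj x)) = h.symm.proj x :=
  Submodule.coe_eq_zero.trans (sub_eq_zero.trans eq_comm)

theorem IsRed.exists_isInvertibleExtension_restr_ker_drazinProj (h : IsRed S M N)
    (hc : IsGeneralizedDrazinInverse (restr S N h.invariant_right) c) :
    ∃ i q d, IsInvertibleExtension (restr S _ (h.isRed_drazinProj hc).invariant_left)
      (restr S M h.invariant_left) i q d := by
  set Y := nullSpace (h.drazinProj c)
  have hY : ∀ y : Y, restr S N h.invariant_right (c (h.symm.proj y)) = h.symm.proj y :=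
    fun y => h.mem_nullSpace_drazinProj_iff.mp y.2
  have hcomm (z : N) : c (restr S N h.invariant_right z) = restr S N h.invariant_right (c z) :=
    (DFunLike.congr_fun hc.comm z).symm
  have hM (m : M) : (m : X) ∈ Y :=
    h.mem_nullSpace_drazinProj_iff.mpr (by rw [h.proj_symm_coe, map_zero, map_zero])
  have hN (y : Y) : (c (h.symm.proj y) : X) ∈ Y :=
    h.mem_nullSpace_drazinProj_iff.mpr (by rw [h.symm.proj_coe, ← hcomm, hY])
  have hsub (y : Y) : (h.symm.proj y : X) = y - h.proj y :=
    eq_sub_of_add_eq' (h.proj_add_proj_symm (y : X))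
  refine ⟨M.subtypeL.codRestrict Y hM, h.proj ∘L Y.subtypeL,
    (N.subtypeL ∘L c ∘L h.symm.proj ∘L Y.subtypeL).codRestrict Y hN, ?_⟩
  exact
    { proj_incl := h.proj_coe
      incl_apply := fun _ => rfl
      proj_apply := fun y => h.proj_apply y
      apply_inv := fun y => Subtype.ext <| (congrArg Subtype.val (hY y)).trans (hsub y)
      inv_apply := fun y => Subtype.ext <| by
        have hinv : c (h.symm.proj (S y)) = h.symm.proj y := by rw [h.symm.proj_apply, hcomm, hY]
        exact (congrArg Subtype.val hinv).trans (hsub y) }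

theorem IsRed.exists_isGKD_of_isGeneralizedDrazinInverse (h : IsRed S M N)
    (hM : IsSemiRegular (restr S M h.invariant_left))
    (hc : IsGeneralizedDrazinInverse (restr S N h.invariant_right) c) :
    ∃ M' N', ∃ h' : IsGKD S M' N',
      nullity (restr S M' h'.invariant_left) = nullity (restr S M h.invariant_left) ∧
      deficiency (restr S M' h'.invariant_left) = deficiency (restr S M h.invariant_left) := by
  obtain ⟨i, q, d, hext⟩ := h.exists_isInvertibleExtension_restr_ker_drazinProj hc
  exact ⟨_, _, ⟨h.isRed_drazinProj hc, hext.isSemiRegular hM,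
    h.isQuasiNilpotent_restr_range_drazinProj hc⟩, hext.nullity_eq, hext.deficiency_eq⟩

end DrazinSplitting

section Perturbation

variable {X : Type*} [NormedAddCommGroup X] [NormedSpace ℂ X] {T : X →L[ℂ] X}
  {M N : Submodule ℂ X}

theorem IsZeroloid.exists_isGeneralizedDrazinInverse_sub_smul_one [CompleteSpace X]
    (hT : IsZeroloid T) {μ : ℂ} (hμ : μ ≠ 0) : ∃ c, IsGeneralizedDrazinInverse (T - μ • 1) c :=
  exists_isGeneralizedDrazinInverse_sub_smul fun hacc => hμ (hT hacc)

theorem IsRed.sub_smul_one (h : IsRed T M N) (μ : ℂ) : IsRed (T - μ • 1) M N where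
  isClosed_left := h.isClosed_left
  isClosed_right := h.isClosed_right
  invariant_left x hx := M.sub_mem (h.invariant_left x hx) (M.smul_mem μ hx)
  invariant_right x hx := N.sub_mem (h.invariant_right x hx) (N.smul_mem μ hx)
  isCompl := h.isCompl

theorem IsRed.restr_sub_smul_one (h : IsRed T M N) (μ : ℂ) :
    restr (T - μ • 1) M (h.sub_smul_one μ).invariant_left = restr T M h.invariant_left - μ • 1 :=
  rfl

theorem IsGzKD.exists_isGKD_sub_smul_one [CompleteSpace X] (h : IsGzKD T M N) {μ : ℂ} (hμ : μ ≠ 0)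
    (hM : IsSemiRegular (restr T M h.invariant_left - μ • 1)) :
    ∃ M' N', ∃ h' : IsGKD (T - μ • 1) M' N',
      nullity (restr (T - μ • 1) M' h'.invariant_left) =
        nullity (restr T M h.invariant_left - μ • 1) ∧
      deficiency (restr (T - μ • 1) M' h'.invariant_left) =
        deficiency (restr T M h.invariant_left - μ • 1) := by
  have : CompleteSpace N := h.isClosed_right.completeSpace_coe
  obtain ⟨c, hc⟩ := h.zeroloid.exists_isGeneralizedDrazinInverse_sub_smul_one hμ
  rw [← h.toIsRed.restr_sub_smul_one] at hM ⊢
  rw [← h.symm.restr_sub_smul_one] at hc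
  exact (h.sub_smul_one μ).exists_isGKD_of_isGeneralizedDrazinInverse hM hc

end Perturbation

end GzKato

theorem theorem2p6 {X : Type*} [NormedAddCommGroup X] [NormedSpace ℂ X] [CompleteSpace X]
    (T : X →L[ℂ] X) (M N : Submodule ℂ X) (h : GzKato.IsGzKD T M N) :
    ∃ ε : ℝ, 0 < ε ∧ ∀ μ : ℂ, μ ∈ Metric.ball (0 : ℂ) ε \ {0} →
      GzKato.IsPseudoFredholm (T - μ • (1 : X →L[ℂ] X)) ∧
      (GzKato.nullity (GzKato.restr T M h.invariant_left) =
          GzKato.dim ↥(GzKato.nullSpace (T - μ • (1 : X →L[ℂ] X)) ⊓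
            GzKato.analyticCore (T - μ • (1 : X →L[ℂ] X))) ∧
        GzKato.dim ↥(GzKato.nullSpace (T - μ • (1 : X →L[ℂ] X)) ⊓
            GzKato.analyticCore (T - μ • (1 : X →L[ℂ] X))) ≤
          GzKato.nullity (T - μ • (1 : X →L[ℂ] X))) ∧
      (GzKato.deficiency (GzKato.restr T M h.invariant_left) =
          GzKato.codim (GzKato.rangeSpace (T - μ • (1 : X →L[ℂ] X)) ⊔
            GzKato.quasiNilpotentPart (T - μ • (1 : X →L[ℂ] X))) ∧
        GzKato.codim (GzKato.rangeSpace (T - μ • (1 : X →L[ℂ] X)) ⊔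
            GzKato.quasiNilpotentPart (T - μ • (1 : X →L[ℂ] X))) ≤
          GzKato.deficiency (T - μ • (1 : X →L[ℂ] X))) := by
  have : CompleteSpace M := h.isClosed_left.completeSpace_coe
  obtain ⟨ε, hε, hM⟩ := Metric.eventually_nhds_iff.mp h.semiRegular.eventually_sub_smul_one
  refine ⟨ε, hε, fun μ ⟨hμε, hμ0⟩ => ?_⟩
  obtain ⟨hsemi, hnull, hdef⟩ := hM hμε
  obtain ⟨M', N', h', hnull', hdef'⟩ := h.exists_isGKD_sub_smul_one hμ0 hsemi
  refine ⟨⟨M', N', h'⟩, ⟨?_, GzKato.dim_mono inf_le_left⟩, ⟨?_, GzKato.codim_antitone le_sup_left⟩⟩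
  · rw [← h'.nullity_restr, hnull', hnull]
  · rw [← h'.deficiency_restr, hdef', hdef]
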